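/- Let $N$ be a connected smooth manifold with a Riemannian metric $h$, let $H$ be a smooth function on $\mathbb{R}\times N$, and let $A(u)$, $u\in\mathbb{R}$, be a family of one-forms on $N$ depending smoothly on $(u,x)$. Consider the $(N,h)$p-wave $(M,g)$ given by these data, that is, $M=\mathbb{R}^2\times N$ with coordinates $(u,v,x)$ and the Lorentzian metric of signature $(-,+,\dots,+)$ $$g = 2\,du\,dv + H(u,x)\,du^2 + 2A(u)\,du + h ,$$ where $2A(u)\,du$ denotes the symmetric form $A(u)\otimes du+du\otimes A(u)$, time-oriented so that the null vector field $\partial_v$ is past-directed. A nonzero tangent vector $X$ is called timelike if $g(X,X)<0$, lightlike if $g(X,X)=0$, and causal if it is timelike or lightlike. Then: 1. $(M,g)$ is causal, i.e. it contains no closed causal curve: there is no piecewise $C^1$ curve $\gamma\colon[a,b]\to M$, $a<b$, with $\gamma(a)=\gamma(b)$, whose velocities (both one-sided velocities at a break point) are all future-directed causal, or all past-directed causal. 2. The coordinate function $u\colon M\to\mathbb{R}$ is a quasi-time function, i.e. it is smooth, $\nabla u$ is everywhere nonzero, causal and past-directed, and every null geodesic segment (a geodesic $\gamma\colon[a,b]\to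 M$, $a<b$, with everywhere lightlike velocity) along which $u$ is constant is injective. -/

import Mathlib

open Bundle Set
open scoped Manifold ContDiff Topology

noncomputable section

section Lorentz

variable {V : Type*} [NormedAddCommGroup V] [NormedSpace ℝ V]
  {K : Type*} [TopologicalSpace K] (I : ModelWithCorners ℝ V K)
  (M : Type*) [TopologicalSpace M] [ChartedSpace K M] [IsManifold I ∞ M]

/-- A smooth Lorentzian metric on `M`, with signature `(-, +, …, +)`. -/
structure LorentzianMetric where
  /-- The scalar product on each tangent space. -/
  inner (p : M) : TangentSpace I p →L[ℝ] TangentSpace I p →L[ℝ] ℝ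
  symm (p : M) (X Y : TangentSpace I p) : inner p X Y = inner p Y X
  /-- There is a negative direction, on whose orthogonal complement the metric is
  positive definite. -/
  signature (p : M) : ∃ T : TangentSpace I p, inner p T T < 0 ∧
    ∀ X : TangentSpace I p, inner p T X = 0 → X ≠ 0 → 0 < inner p X X
  contMDiff : ContMDiff I (I.prod 𝓘(ℝ, V →L[ℝ] V →L[ℝ] ℝ)) ∞
    (fun p : M ↦ TotalSpace.mk' (V →L[ℝ] V →L[ℝ] ℝ)
      (E := fun p : M ↦ TangentSpace I p →L[ℝ] TangentSpace I p →L[ℝ] ℝ) p (inner p))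

variable {I M}

namespace LorentzianMetric

variable (g : LorentzianMetric I M)

def IsTimelike {p : M} (X : TangentSpace I p) : Prop := g.inner p X X < 0

/-- Nonzero null vectors; the zero vector is not lightlike. -/
def IsLightlike {p : M} (X : TangentSpace I p) : Prop := X ≠ 0 ∧ g.inner p X X = 0

def IsCausalVector {p : M} (X : TangentSpace I p) : Prop := g.IsTimelike X ∨ g.IsLightlike X

/-- A time orientation, given by a continuous global timelike vector field (which is declared to
be future-directed). -/
structure TimeOrientation where
  /-- The timelike vector field. -/
  field (p : M) : TangentSpace I p
  continuous : Continuous (fun p : M ↦ (⟨p, field p⟩ : TangentBundle I M))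
  timelike (p : M) : g.IsTimelike (field p)

variable {g} in
/-- A causal vector in the same time cone as the time-orienting vector. -/
def TimeOrientation.FutureDirected (τ : g.TimeOrientation) {p : M} (X : TangentSpace I p) : Prop :=
  g.IsCausalVector X ∧ g.inner p X (τ.field p) < 0

variable {g} in
/-- A causal vector in the time cone opposite to the time-orienting vector. -/
def TimeOrientation.PastDirected (τ : g.TimeOrientation) {p : M} (X : TangentSpace I p) : Prop :=
  g.IsCausalVector X ∧ 0 < g.inner p X (τ.field p)

end LorentzianMetric

/-- The velocity at time `s` of a curve `γ` defined on the set `J` of times (one-sided at the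
end points of an interval `J`). -/
def velocityWithin (I : ModelWithCorners ℝ V K) {M : Type*} [TopologicalSpace M] [ChartedSpace K M]
    (γ : ℝ → M) (J : Set ℝ) (s : ℝ) : TangentSpace I (γ s) :=
  mfderivWithin 𝓘(ℝ, ℝ) I γ J s (1 : ℝ)

namespace LorentzianMetric

variable (g : LorentzianMetric I M)

/-- `γ : [a, b] → M` is piecewise continuously differentiable, and all its velocities (both
one-sided velocities at a break point) satisfy the property `P`. -/
def PiecewiseWithVelocity (P : ∀ p : M, TangentSpace I p → Prop) (γ : ℝ → M) (a b : ℝ) : Prop :=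
  ∃ (n : ℕ) (t : ℕ → ℝ), t 0 = a ∧ t n = b ∧ ∀ i < n, t i < t (i + 1) ∧
    ContMDiffOn 𝓘(ℝ, ℝ) I 1 γ (Icc (t i) (t (i + 1))) ∧
    ∀ s ∈ Icc (t i) (t (i + 1)), P (γ s) (velocityWithin I γ (Icc (t i) (t (i + 1))) s)

variable {g} in
/-- A causal curve `γ : [a, b] → M`: piecewise `C¹`, and either everywhere future-directed causal
or everywhere past-directed causal. -/
def IsCausalCurve (τ : g.TimeOrientation) (γ : ℝ → M) (a b : ℝ) : Prop :=
  PiecewiseWithVelocity (fun _ X ↦ τ.FutureDirected X) γ a b ∨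
  PiecewiseWithVelocity (fun _ X ↦ τ.PastDirected X) γ a b

variable {g} in
/-- The spacetime is causal: there is no closed causal curve. -/
def IsCausal (τ : g.TimeOrientation) : Prop :=
  ¬ ∃ (γ : ℝ → M) (a b : ℝ), a < b ∧ IsCausalCurve τ γ a b ∧ γ a = γ b

/-- `X` is the gradient of `f` at `p`: `g(X, Y) = df(Y)` for all `Y` in the tangent space.
Since `g` is nondegenerate, at most one vector has this property. -/
def IsGradientAt (f : M → ℝ) (p : M) (X : TangentSpace I p) : Prop :=
  ∀ Y : TangentSpace I p, g.inner p X Y = mfderiv I 𝓘(ℝ, ℝ) f p Y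

/-- The component `g(a, b)` of the metric in the chart around `q`, as a function of the point `y`
of the coordinate space; `a` and `b` are vectors of the coordinate space. -/
def chartComponent (q : M) (a b : V) (y : V) : ℝ :=
  g.inner ((extChartAt I q).symm y)
    (mfderivWithin 𝓘(ℝ, V) I (extChartAt I q).symm (range I) y a)
    (mfderivWithin 𝓘(ℝ, V) I (extChartAt I q).symm (range I) y b)

/-- The Christoffel symbols of the first kind of the Levi-Civita connection in the chart
around `q`: `½ (∂_a g(b, c) + ∂_b g(a, c) - ∂_c g(a, b))`, which is `g(∇_a b, c)` for the constant
coordinate vector fields `a`, `b`, `c`. -/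
def christoffel (q : M) (a b c : V) (y : V) : ℝ :=
  (fderivWithin ℝ (g.chartComponent q b c) (range I) y a
    + fderivWithin ℝ (g.chartComponent q a c) (range I) y b
    - fderivWithin ℝ (g.chartComponent q a b) (range I) y c) / 2

/-- `γ : [a, b] → M` is a geodesic segment: it is `C²` and in each of the charts around points
of `M` its coordinate expression `y` satisfies the geodesic equation `∇_{y'} y' = 0`, written
here with the index lowered as `g(y'', c) + Γ(y', y', c) = 0` for all `c`. -/
def IsGeodesicSegment (γ : ℝ → M) (a b : ℝ) : Prop :=
  a < b ∧ ContMDiffOn 𝓘(ℝ, ℝ) I 2 γ (Icc a b) ∧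
  ∀ q : M, ∀ s ∈ Icc a b, γ s ∈ (chartAt K q).source → ∀ c : V,
    let y : ℝ → V := fun r ↦ extChartAt I q (γ r)
    let y' : ℝ → V := derivWithin y (Icc a b)
    let y'' : ℝ → V := derivWithin y' (Icc a b)
    g.chartComponent q (y'' s) c (y s) + g.christoffel q (y' s) (y' s) c (y s) = 0

/-- A null geodesic segment: a geodesic segment with lightlike (in particular nonzero)
velocity. -/
def IsNullGeodesicSegment (γ : ℝ → M) (a b : ℝ) : Prop :=
  g.IsGeodesicSegment γ a b ∧
    ∀ s ∈ Icc a b, g.IsLightlike (velocityWithin I γ (Icc a b) s)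

variable {g} in
/-- A quasi-time function: a smooth function whose gradient is everywhere nonzero, causal and
past-directed, and such that every null geodesic segment along which it is constant is
injective. -/
def IsQuasiTimeFunction (τ : g.TimeOrientation) (f : M → ℝ) : Prop :=
  ContMDiff I 𝓘(ℝ, ℝ) ∞ f ∧
  (∀ p : M, ∃ X : TangentSpace I p,
    g.IsGradientAt f p X ∧ X ≠ 0 ∧ g.IsCausalVector X ∧ τ.PastDirected X) ∧
  ∀ (γ : ℝ → M) (a b : ℝ), g.IsNullGeodesicSegment γ a b →
    (∃ c : ℝ, ∀ s ∈ Icc a b, f (γ s) = c) → InjOn γ (Icc a b)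

end LorentzianMetric

/-- A field of linear maps out of the tangent spaces is smooth if its values on smooth vector
fields are. -/
lemma contMDiffAt_hom_of_apply [FiniteDimensional ℝ V]
    {F : Type*} [NormedAddCommGroup F] [NormedSpace ℝ F]
    {W : M → Type*} [∀ p, AddCommGroup (W p)] [∀ p, Module ℝ (W p)]
    [TopologicalSpace (TotalSpace F W)] [∀ p, TopologicalSpace (W p)]
    [∀ p, IsTopologicalAddGroup (W p)] [∀ p, ContinuousSMul ℝ (W p)]
    [FiberBundle F W] [VectorBundle ℝ F W]
    (B : (p : M) → TangentSpace I p →L[ℝ] W p) (p₀ : M)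
    (hB : ∀ (X : (p : M) → TangentSpace I p),
      ContMDiffAt I (I.prod 𝓘(ℝ, V)) ∞ (fun p ↦ (⟨p, X p⟩ : TangentBundle I M)) p₀ →
      ContMDiffAt I (I.prod 𝓘(ℝ, F)) ∞ (fun p ↦ TotalSpace.mk' F p (B p (X p))) p₀) :
    ContMDiffAt I (I.prod 𝓘(ℝ, V →L[ℝ] F)) ∞
      (fun p : M ↦ TotalSpace.mk' (V →L[ℝ] F)
        (E := fun p : M ↦ TangentSpace I p →L[ℝ] W p) p (B p)) p₀ := by
  rw [contMDiffAt_hom_bundle]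
  refine ⟨contMDiffAt_id, ?_⟩
  set e := trivializationAt V (TangentSpace I) p₀
  have hp₀ : p₀ ∈ e.baseSet := FiberBundle.mem_baseSet_trivializationAt' p₀
  have key : ∀ v : V, ContMDiffAt I 𝓘(ℝ, F) ∞
      (fun p ↦ ContinuousLinearMap.inCoordinates V (TangentSpace I) F W p₀ p p₀ p (B p) v) p₀ := by
    intro v
    have hX : ContMDiffAt I (I.prod 𝓘(ℝ, V)) ∞
        (fun p ↦ (⟨p, e.symmL ℝ p v⟩ : TangentBundle I M)) p₀ := by
      rw [contMDiffAt_section]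
      refine (contMDiffAt_const (c := v)).congr_of_eventuallyEq ?_
      filter_upwards [e.open_baseSet.mem_nhds hp₀] with p hp
      have := e.apply_mk_symm hp v
      rw [e.symmL_apply hp]
      exact congrArg Prod.snd this
    have := hB _ hX
    rw [contMDiffAt_section] at this
    refine this.congr_of_eventuallyEq ?_
    have hopen := (trivializationAt F W p₀).open_baseSet.mem_nhds
      (FiberBundle.mem_baseSet_trivializationAt' p₀)
    filter_upwards [hopen] with p hp
    simp only [ContinuousLinearMap.inCoordinates, ContinuousLinearMap.comp_apply]
    rw [Trivialization.continuousLinearMapAt_apply, Trivialization.coe_linearMapAt_of_mem _ hp]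
  let b := Module.finBasis ℝ V
  have hsum : ∀ L : V →L[ℝ] F, L = ∑ i,
      ContinuousLinearMap.smulRightL ℝ V F (LinearMap.toContinuousLinearMap (b.coord i))
        (L (b i)) := by
    intro L
    ext v
    conv_lhs => rw [← b.sum_repr v, map_sum]
    simp
  have : (fun p ↦ ContinuousLinearMap.inCoordinates V (TangentSpace I) F W p₀ p p₀ p (B p)) =
      fun p ↦ ∑ i, ContinuousLinearMap.smulRightL ℝ V F
        (LinearMap.toContinuousLinearMap (b.coord i))
        (ContinuousLinearMap.inCoordinates V (TangentSpace I) F W p₀ p p₀ p (B p) (b i)) := by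
    funext p
    exact hsum _
  rw [this]
  refine contMDiffAt_finsetSum fun i _ ↦ ?_
  exact (ContinuousLinearMap.contMDiff _).contMDiffAt.comp p₀ (key (b i))

/-- A field of bilinear forms is smooth if its values on pairs of smooth vector fields are. -/
lemma contMDiff_form_of_apply [FiniteDimensional ℝ V]
    (B : (p : M) → TangentSpace I p →L[ℝ] TangentSpace I p →L[ℝ] ℝ)
    (hB : ∀ (p₀ : M) (X Y : (p : M) → TangentSpace I p),
      ContMDiffAt I (I.prod 𝓘(ℝ, V)) ∞ (fun p ↦ (⟨p, X p⟩ : TangentBundle I M)) p₀ →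
      ContMDiffAt I (I.prod 𝓘(ℝ, V)) ∞ (fun p ↦ (⟨p, Y p⟩ : TangentBundle I M)) p₀ →
      ContMDiffAt I 𝓘(ℝ, ℝ) ∞ (fun p ↦ B p (X p) (Y p)) p₀) :
    ContMDiff I (I.prod 𝓘(ℝ, V →L[ℝ] V →L[ℝ] ℝ)) ∞
      (fun p : M ↦ TotalSpace.mk' (V →L[ℝ] V →L[ℝ] ℝ)
        (E := fun p : M ↦ TangentSpace I p →L[ℝ] TangentSpace I p →L[ℝ] ℝ) p (B p)) := by
  intro p₀
  refine contMDiffAt_hom_of_apply (W := fun p : M ↦ TangentSpace I p →L[ℝ] ℝ) B p₀ fun X hX ↦ ?_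
  refine contMDiffAt_hom_of_apply (W := Bundle.Trivial M ℝ) (fun p ↦ B p (X p)) p₀ fun Y hY ↦ ?_
  rw [contMDiffAt_section]
  exact hB p₀ X Y hX hY

end Lorentz

section Wave

variable (E : Type*) [NormedAddCommGroup E] [NormedSpace ℝ E]
  (N : Type*) [TopologicalSpace N] [ChartedSpace E N] [IsManifold 𝓘(ℝ, E) ∞ N]

/-- The model with corners of `ℝ × ℝ × N`, with coordinates `(u, v, x)`. -/
abbrev waveModel : ModelWithCorners ℝ (ℝ × ℝ × E) (ModelProd ℝ (ModelProd ℝ E)) :=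
  𝓘(ℝ, ℝ).prod (𝓘(ℝ, ℝ).prod 𝓘(ℝ, E))

/-- An `(N, h)`p-wave is the manifold `ℝ × ℝ × N`, with coordinates `(u, v, x)`, carrying the metric
`2 du dv + H(u) du² + 2 A(u) du + h`. This structure holds the data of such a wave: a Riemannian metric `h` on `N`, a smooth function `H(u, x)`, and
a `u`-dependent one-form `A(u)` on `N`, smooth in `(u, x)`. -/
structure NhpWave where
  /-- The Riemannian metric on the wavefront. -/
  h : ContMDiffRiemannianMetric 𝓘(ℝ, E) ∞ E (fun x : N ↦ TangentSpace 𝓘(ℝ, E) x)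
  /-- The characteristic function. -/
  H : ℝ → N → ℝ
  contMDiff_H : ContMDiff (𝓘(ℝ, ℝ).prod 𝓘(ℝ, E)) 𝓘(ℝ, ℝ) ∞ (fun z : ℝ × N ↦ H z.1 z.2)
  /-- The one-form of the mixed terms. -/
  A : ℝ → (x : N) → TangentSpace 𝓘(ℝ, E) x →L[ℝ] ℝ
  contMDiff_A : ContMDiff (𝓘(ℝ, ℝ).prod 𝓘(ℝ, E)) (𝓘(ℝ, E).prod 𝓘(ℝ, E →L[ℝ] ℝ)) ∞
    (fun z : ℝ × N ↦ TotalSpace.mk' (E →L[ℝ] ℝ)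
      (E := fun x : N ↦ TangentSpace 𝓘(ℝ, E) x →L[ℝ] ℝ) z.2 (A z.1 z.2))

variable {E N}

/-- The bilinear form `2 du dv + H du² + 2 A du + h` on `ℝ × ℝ × E`. -/
def waveForm (H : ℝ) (A : E →L[ℝ] ℝ) (h : E →L[ℝ] E →L[ℝ] ℝ) :
    (ℝ × ℝ × E) →L[ℝ] (ℝ × ℝ × E) →L[ℝ] ℝ :=
  let du : (ℝ × ℝ × E) →L[ℝ] ℝ := ContinuousLinearMap.fst ℝ ℝ (ℝ × E)
  let dv : (ℝ × ℝ × E) →L[ℝ] ℝ :=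
    (ContinuousLinearMap.fst ℝ ℝ E).comp (ContinuousLinearMap.snd ℝ ℝ (ℝ × E))
  let dx : (ℝ × ℝ × E) →L[ℝ] E :=
    (ContinuousLinearMap.snd ℝ ℝ E).comp (ContinuousLinearMap.snd ℝ ℝ (ℝ × E))
  du.smulRight dv + dv.smulRight du + H • du.smulRight du
    + du.smulRight (A.comp dx) + (A.comp dx).smulRight du + h.bilinearComp dx dx

lemma waveForm_apply (H : ℝ) (A : E →L[ℝ] ℝ) (h : E →L[ℝ] E →L[ℝ] ℝ) (X Y : ℝ × ℝ × E) :
    waveForm H A h X Y = X.1 * Y.2.1 + X.2.1 * Y.1 + H * (X.1 * Y.1)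
      + (X.1 * A Y.2.2 + A X.2.2 * Y.1) + h X.2.2 Y.2.2 := by
  simp [waveForm]
  ring


lemma waveForm_symm (H : ℝ) (A : E →L[ℝ] ℝ) (h : E →L[ℝ] E →L[ℝ] ℝ) (hs : ∀ a b, h a b = h b a)
    (X Y : ℝ × ℝ × E) : waveForm H A h X Y = waveForm H A h Y X := by
  rw [waveForm_apply, waveForm_apply, hs]
  ring

/-- The vector `∂_u - (H + 1) / 2 ∂_v`. -/
def waveTimelike (H : ℝ) : ℝ × ℝ × E := (1, -((H + 1) / 2), 0)

lemma waveForm_timelike (H : ℝ) (A : E →L[ℝ] ℝ) (h : E →L[ℝ] E →L[ℝ] ℝ) :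
    waveForm H A h (waveTimelike H) (waveTimelike H) < 0 := by
  rw [waveForm_apply]
  simp [waveTimelike]
  linarith

lemma waveForm_pos (H : ℝ) (A : E →L[ℝ] ℝ) (h : E →L[ℝ] E →L[ℝ] ℝ) (hp : ∀ a, a ≠ 0 → 0 < h a a)
    (X : ℝ × ℝ × E) (hX : waveForm H A h (waveTimelike H) X = 0) (h0 : X ≠ 0) :
    0 < waveForm H A h X X := by
  obtain ⟨a, b, ξ⟩ := X
  rw [waveForm_apply] at hX ⊢
  simp only [waveTimelike, map_zero, zero_apply] at hX ⊢
  have hb : b = (1 - H) / 2 * a - A ξ := by linarith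
  have he : a * b + b * a + H * (a * a) + (a * A ξ + A ξ * a) + h ξ ξ = a ^ 2 + h ξ ξ := by
    rw [hb]
    ring
  rw [he]
  by_cases hξ : ξ = 0
  · have ha : a ≠ 0 := by
      rintro rfl
      apply h0
      simp [hb, hξ]
    have := sq_pos_of_ne_zero ha
    simpa [hξ] using this
  · have := hp ξ hξ
    positivity

lemma contMDiffAt_wave_u {p₀ : ℝ × ℝ × N} {X : (p : ℝ × ℝ × N) → TangentSpace (waveModel E) p}
    (hX : ContMDiffAt (waveModel E) ((waveModel E).prod 𝓘(ℝ, ℝ × ℝ × E)) ∞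
      (fun p ↦ (⟨p, X p⟩ : TangentBundle (waveModel E) (ℝ × ℝ × N))) p₀) :
    ContMDiffAt (waveModel E) 𝓘(ℝ, ℝ) ∞ (fun p ↦ (X p).1) p₀ := by
  have h1 := (contMDiff_fst (I := 𝓘(ℝ, ℝ)) (J := 𝓘(ℝ, ℝ).prod 𝓘(ℝ, E)) (M := ℝ) (N := ℝ × N)
    (n := ∞)).contMDiff_tangentMap (m := ∞) le_rfl
  have h2 := ((contMDiff_snd_tangentBundle_modelSpace ℝ 𝓘(ℝ, ℝ)).comp h1).contMDiffAt.comp p₀ hX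
  refine h2.congr_of_eventuallyEq (Filter.Eventually.of_forall fun p ↦ ?_)
  simp only [Function.comp, tangentMap, mfderiv_fst]
  rfl

lemma contMDiffAt_wave_tail {p₀ : ℝ × ℝ × N} {X : (p : ℝ × ℝ × N) → TangentSpace (waveModel E) p}
    (hX : ContMDiffAt (waveModel E) ((waveModel E).prod 𝓘(ℝ, ℝ × ℝ × E)) ∞
      (fun p ↦ (⟨p, X p⟩ : TangentBundle (waveModel E) (ℝ × ℝ × N))) p₀) :
    ContMDiffAt (waveModel E) ((𝓘(ℝ, ℝ).prod 𝓘(ℝ, E)).prod 𝓘(ℝ, ℝ × E)) ∞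
      (fun p ↦ (⟨p.2, (X p).2⟩ : TangentBundle (𝓘(ℝ, ℝ).prod 𝓘(ℝ, E)) (ℝ × N))) p₀ := by
  have h1 := (contMDiff_snd (I := 𝓘(ℝ, ℝ)) (J := 𝓘(ℝ, ℝ).prod 𝓘(ℝ, E)) (M := ℝ) (N := ℝ × N)
    (n := ∞)).contMDiff_tangentMap (m := ∞) le_rfl
  have h2 := h1.contMDiffAt.comp p₀ hX
  refine h2.congr_of_eventuallyEq (Filter.Eventually.of_forall fun p ↦ ?_)
  simp only [Function.comp, tangentMap, mfderiv_snd]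
  rfl

lemma contMDiffAt_wave_v {p₀ : ℝ × ℝ × N} {X : (p : ℝ × ℝ × N) → TangentSpace (waveModel E) p}
    (hX : ContMDiffAt (waveModel E) ((waveModel E).prod 𝓘(ℝ, ℝ × ℝ × E)) ∞
      (fun p ↦ (⟨p, X p⟩ : TangentBundle (waveModel E) (ℝ × ℝ × N))) p₀) :
    ContMDiffAt (waveModel E) 𝓘(ℝ, ℝ) ∞ (fun p ↦ (X p).2.1) p₀ := by
  have h1 := (contMDiff_fst (I := 𝓘(ℝ, ℝ)) (J := 𝓘(ℝ, E)) (M := ℝ) (N := N)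
    (n := ∞)).contMDiff_tangentMap (m := ∞) le_rfl
  have h2 := ((contMDiff_snd_tangentBundle_modelSpace ℝ 𝓘(ℝ, ℝ)).comp h1).contMDiffAt.comp p₀
    (contMDiffAt_wave_tail hX)
  refine h2.congr_of_eventuallyEq (Filter.Eventually.of_forall fun p ↦ ?_)
  simp only [Function.comp, tangentMap, mfderiv_fst]
  rfl

lemma contMDiffAt_wave_x {p₀ : ℝ × ℝ × N} {X : (p : ℝ × ℝ × N) → TangentSpace (waveModel E) p}
    (hX : ContMDiffAt (waveModel E) ((waveModel E).prod 𝓘(ℝ, ℝ × ℝ × E)) ∞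
      (fun p ↦ (⟨p, X p⟩ : TangentBundle (waveModel E) (ℝ × ℝ × N))) p₀) :
    ContMDiffAt (waveModel E) (𝓘(ℝ, E).prod 𝓘(ℝ, E)) ∞
      (fun p ↦ (⟨p.2.2, (X p).2.2⟩ : TangentBundle 𝓘(ℝ, E) N)) p₀ := by
  have h1 := (contMDiff_snd (I := 𝓘(ℝ, ℝ)) (J := 𝓘(ℝ, E)) (M := ℝ) (N := N)
    (n := ∞)).contMDiff_tangentMap (m := ∞) le_rfl
  have h2 := h1.contMDiffAt.comp p₀ (contMDiffAt_wave_tail hX)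
  refine h2.congr_of_eventuallyEq (Filter.Eventually.of_forall fun p ↦ ?_)
  simp only [Function.comp, tangentMap, mfderiv_snd]
  rfl

/-- The metric `g = 2 du dv + H(u) du² + 2 A(u) du + h` on `ℝ × ℝ × N`. -/
def NhpWave.metric [FiniteDimensional ℝ E] (W : NhpWave E N) : LorentzianMetric (waveModel E) (ℝ × ℝ × N) where
  inner p := waveForm (E := E) (W.H p.1 p.2.2) (W.A p.1 p.2.2) (W.h.inner p.2.2)
  symm p X Y := waveForm_symm (E := E) _ _ _ (W.h.symm p.2.2) X Y
  signature p := ⟨waveTimelike (W.H p.1 p.2.2), waveForm_timelike (E := E) _ _ _,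
    waveForm_pos (E := E) _ _ _ (W.h.pos p.2.2)⟩
  contMDiff := by
    refine contMDiff_form_of_apply _ fun p₀ X Y hX hY ↦ ?_
    have hux : ContMDiff (waveModel E) (𝓘(ℝ, ℝ).prod 𝓘(ℝ, E)) ∞
        (fun p : ℝ × ℝ × N ↦ (p.1, p.2.2)) :=
      contMDiff_fst.prodMk (contMDiff_snd.comp contMDiff_snd)
    have hH : ContMDiffAt (waveModel E) 𝓘(ℝ, ℝ) ∞ (fun p : ℝ × ℝ × N ↦ W.H p.1 p.2.2) p₀ :=
      (W.contMDiff_H.comp hux).contMDiffAt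
    have hA (Z : (p : ℝ × ℝ × N) → TangentSpace (waveModel E) p)
        (hZ : ContMDiffAt (waveModel E) ((waveModel E).prod 𝓘(ℝ, ℝ × ℝ × E)) ∞
          (fun p ↦ (⟨p, Z p⟩ : TangentBundle (waveModel E) (ℝ × ℝ × N))) p₀) :
        ContMDiffAt (waveModel E) 𝓘(ℝ, ℝ) ∞
          (fun p : ℝ × ℝ × N ↦ W.A p.1 p.2.2 (Z p).2.2) p₀ := by
      have h := ContMDiffAt.clm_bundle_apply (F₁ := E) (F₂ := ℝ)
        (E₁ := fun x : N ↦ TangentSpace 𝓘(ℝ, E) x) (E₂ := Bundle.Trivial N ℝ)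
        (b := fun p : ℝ × ℝ × N ↦ p.2.2)
        (ϕ := fun p ↦ W.A p.1 p.2.2) (v := fun p ↦ (Z p).2.2)
        (W.contMDiff_A.comp hux).contMDiffAt (contMDiffAt_wave_x hZ)
      simp only [contMDiffAt_totalSpace] at h
      exact h.2
    have hh : ContMDiffAt (waveModel E) 𝓘(ℝ, ℝ) ∞
          (fun p : ℝ × ℝ × N ↦ W.h.inner p.2.2 (X p).2.2 (Y p).2.2) p₀ := by
      have h := ContMDiffAt.clm_bundle_apply₂ (F₁ := E) (F₂ := E) (F₃ := ℝ)
        (E₁ := fun x : N ↦ TangentSpace 𝓘(ℝ, E) x) (E₂ := fun x : N ↦ TangentSpace 𝓘(ℝ, E) x)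
        (E₃ := Bundle.Trivial N ℝ)
        (b := fun p : ℝ × ℝ × N ↦ p.2.2)
        (ψ := fun p ↦ W.h.inner p.2.2) (v := fun p ↦ (X p).2.2) (w := fun p ↦ (Y p).2.2)
        (W.h.contMDiff.comp (contMDiff_snd.comp contMDiff_snd)).contMDiffAt
        (contMDiffAt_wave_x hX) (contMDiffAt_wave_x hY)
      simp only [contMDiffAt_totalSpace] at h
      exact h.2
    have hs := ((((contMDiffAt_wave_u hX).mul (contMDiffAt_wave_v hY)).add
      ((contMDiffAt_wave_v hX).mul (contMDiffAt_wave_u hY))).add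
      (hH.mul ((contMDiffAt_wave_u hX).mul (contMDiffAt_wave_u hY)))).add
      (((contMDiffAt_wave_u hX).mul (hA Y hY)).add ((hA X hX).mul (contMDiffAt_wave_u hY)))
    refine (hs.add hh).congr_of_eventuallyEq (Filter.Eventually.of_forall fun p ↦ ?_)
    exact waveForm_apply (E := E) _ _ _ (X p) (Y p)

variable (E N) in
/-- The coordinate vector field `∂_v`. -/
def coordV (p : ℝ × ℝ × N) : TangentSpace (waveModel E) p := ((0, 1, 0) : ℝ × ℝ × E)

lemma contMDiff_scalar_section (f : ℝ × ℝ × N → ℝ) (c : ℝ × ℝ × N → ℝ)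
    (hf : ContMDiff (waveModel E) 𝓘(ℝ, ℝ) ∞ f) (hc : ContMDiff (waveModel E) 𝓘(ℝ, ℝ) ∞ c) :
    ContMDiff (waveModel E) (𝓘(ℝ, ℝ).prod 𝓘(ℝ, ℝ)) ∞
      (fun p ↦ (⟨f p, c p⟩ : TangentBundle 𝓘(ℝ, ℝ) ℝ)) := by
  intro p
  rw [contMDiffAt_totalSpace]
  refine ⟨hf p, (hc p).congr_of_eventuallyEq (Filter.Eventually.of_forall fun q ↦ ?_)⟩
  simp

/-- An `(N, h)`p-wave carries a time orientation for which `∂_v` is past-directed. -/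
theorem NhpWave.exists_timeOrientation [FiniteDimensional ℝ E] (W : NhpWave E N) :
    ∃ τ : W.metric.TimeOrientation, ∀ p, τ.PastDirected (coordV E N p) := by
  have hux : ContMDiff (waveModel E) (𝓘(ℝ, ℝ).prod 𝓘(ℝ, E)) ∞
      (fun p : ℝ × ℝ × N ↦ (p.1, p.2.2)) :=
    contMDiff_fst.prodMk (contMDiff_snd.comp contMDiff_snd)
  have hH : ContMDiff (waveModel E) 𝓘(ℝ, ℝ) ∞ (fun p : ℝ × ℝ × N ↦ W.H p.1 p.2.2) :=
    W.contMDiff_H.comp hux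
  have hc : ContMDiff (waveModel E) 𝓘(ℝ, ℝ) ∞
      (fun p : ℝ × ℝ × N ↦ -((W.H p.1 p.2.2 + 1) / 2)) := by
    have h2 : ContDiff ℝ ∞ (fun r : ℝ ↦ -((r + 1) / 2)) := by fun_prop
    exact h2.contMDiff.comp hH
  have h1 := contMDiff_scalar_section (E := E) (N := N) (fun p ↦ p.1) (fun _ ↦ 1)
    contMDiff_fst contMDiff_const
  have h2 := contMDiff_scalar_section (E := E) (N := N) (fun p ↦ p.2.1) _
    (contMDiff_fst.comp contMDiff_snd) hc
  have h3 : ContMDiff (waveModel E) (𝓘(ℝ, E).prod 𝓘(ℝ, E)) ∞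
      (fun p : ℝ × ℝ × N ↦ (⟨p.2.2, 0⟩ : TangentBundle 𝓘(ℝ, E) N)) :=
    (Bundle.contMDiff_zeroSection ℝ (TangentSpace 𝓘(ℝ, E) (M := N))).comp
      (contMDiff_snd.comp contMDiff_snd)
  have h23 := contMDiff_equivTangentBundleProd_symm.comp (h2.prodMk h3)
  have h123 := contMDiff_equivTangentBundleProd_symm.comp (h1.prodMk h23)
  refine ⟨⟨fun p ↦ waveTimelike (W.H p.1 p.2.2), h123.continuous,
    fun p ↦ waveForm_timelike (E := E) _ _ _⟩, fun p ↦ ⟨Or.inr ⟨?_, ?_⟩, ?_⟩⟩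
  · intro h
    have : ((0, 1, 0) : ℝ × ℝ × E) = 0 := h
    simp at this
  · refine (waveForm_apply (E := E) _ _ _ _ _).trans ?_
    simp [coordV]
  · refine lt_of_lt_of_eq ?_ (waveForm_apply (E := E) _ _ _ _ _).symm
    have h0 : W.A p.1 p.2.2 (0 : E) = 0 := map_zero (W.A p.1 p.2.2)
    simp only [coordV, waveTimelike]
    norm_num
    exact zero_lt_one.trans_eq ((add_zero 1).symm.trans (congrArg (1 + ·) h0.symm))

end Wave
end

/-!
In a Lorentzian vector space two orthogonal causal vectors are proportional. Hence, if the gradient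
of `f` is past-directed, `f` is nondecreasing along every future-directed causal curve, and wherever
`f` is stationary the velocity is a negative multiple of the gradient. If a second function `k`
increases in the direction of the gradient of `f`, the pair `(f, -k)` therefore increases
lexicographically along future-directed causal curves, which rules out closed ones; and a lightlike
curve along which `f` is constant is an integral curve of the gradient up to parametrization, so `k`
is injective along it. In an `(N, h)`p-wave, `∂_v` is the gradient of `u`, and one takes `k = v`.
-/

section Calculus

variable {f f' k k' : ℝ → ℝ}

lemma toLex_lt_toLex_of_hasDerivWithinAt {a b : ℝ} (hab : a < b)
    (hf : ∀ s ∈ Icc a b, HasDerivWithinAt f (f' s) (Icc a b) s)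
    (hk : ∀ s ∈ Icc a b, HasDerivWithinAt k (k' s) (Icc a b) s)
    (hf' : ∀ s ∈ Icc a b, 0 ≤ f' s) (hk' : ∀ s ∈ Icc a b, f' s = 0 → 0 < k' s) :
    toLex (f a, k a) < toLex (f b, k b) := by
  have ha : a ∈ Icc a b := left_mem_Icc.2 hab.le
  have hb : b ∈ Icc a b := right_mem_Icc.2 hab.le
  have hmono : MonotoneOn f (Icc a b) :=
    monotoneOn_of_hasDerivWithinAt_nonneg (convex_Icc a b)
      (fun s hs ↦ (hf s hs).continuousWithinAt)
      (fun s hs ↦ (hf s (interior_subset hs)).mono interior_subset)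
      (fun s hs ↦ hf' s (interior_subset hs))
  rw [Prod.Lex.toLex_lt_toLex]
  refine (hmono ha hb hab.le).lt_or_eq.imp_right fun heq ↦ ⟨heq, ?_⟩
  have hconst : ∀ s ∈ Icc a b, f s = f a := fun s hs ↦
    le_antisymm ((hmono hs hb hs.2).trans_eq heq.symm) (hmono ha hs hs.1)
  have hzero : ∀ s ∈ Icc a b, f' s = 0 := fun s hs ↦
    (uniqueDiffOn_Icc hab s hs).eq_deriv _ (hf s hs)
      ((hasDerivWithinAt_const s _ (f a)).congr hconst (hconst s hs))
  exact strictMonoOn_of_hasDerivWithinAt_pos (convex_Icc a b)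
    (fun s hs ↦ (hk s hs).continuousWithinAt)
    (fun s hs ↦ (hk s (interior_subset hs)).mono interior_subset)
    (fun s hs ↦ hk' s (interior_subset hs) (hzero s (interior_subset hs))) ha hb hab

lemma injOn_of_hasDerivWithinAt_ne_zero {D : Set ℝ} (hD : Convex ℝ D)
    (hf : ∀ s ∈ D, HasDerivWithinAt f (f' s) D s) (hf' : ∀ s ∈ D, f' s ≠ 0) : InjOn f D := by
  have hcont : ContinuousOn f D := fun s hs ↦ (hf s hs).continuousWithinAt
  have hderiv : ∀ s ∈ interior D, HasDerivWithinAt f (f' s) (interior D) s :=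
    fun s hs ↦ (hf s (interior_subset hs)).mono interior_subset
  rcases hasDerivWithinAt_forall_lt_or_forall_gt_of_forall_ne hD hf hf' with hneg | hpos
  · exact (strictAntiOn_of_hasDerivWithinAt_neg hD hcont hderiv
      fun s hs ↦ hneg s (interior_subset hs)).injOn
  · exact (strictMonoOn_of_hasDerivWithinAt_pos hD hcont hderiv
      fun s hs ↦ hpos s (interior_subset hs)).injOn

end Calculus

section Lorentz

variable {V : Type*} [NormedAddCommGroup V] [NormedSpace ℝ V]
  {K : Type*} [TopologicalSpace K] {I : ModelWithCorners ℝ V K}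
  {M : Type*} [TopologicalSpace M] [ChartedSpace K M]

lemma hasDerivWithinAt_comp_velocityWithin {f : M → ℝ} {γ : ℝ → M} {J : Set ℝ} {s : ℝ}
    (hf : MDifferentiableAt I 𝓘(ℝ, ℝ) f (γ s))
    (hγ : MDifferentiableWithinAt 𝓘(ℝ, ℝ) I γ J s) :
    HasDerivWithinAt (fun r ↦ f (γ r)) (mvfderiv I f (γ s) (velocityWithin I γ J s)) J s := by
  have h : HasFDerivWithinAt (fun r ↦ f (γ r))
      ((mvfderiv I f (γ s)).comp (mfderivWithin 𝓘(ℝ, ℝ) I γ J s : ℝ →L[ℝ] TangentSpace I (γ s)))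
      J s :=
    (hf.hasMFDerivAt.comp_hasMFDerivWithinAt s hγ.hasMFDerivWithinAt).hasFDerivWithinAt
  exact h.hasDerivWithinAt

namespace LorentzianMetric

lemma PiecewiseWithVelocity.toLex_lt_toLex {P : ∀ p : M, TangentSpace I p → Prop} {f k : M → ℝ}
    (hf : MDifferentiable I 𝓘(ℝ, ℝ) f) (hk : MDifferentiable I 𝓘(ℝ, ℝ) k)
    (hP : ∀ (p : M) (X : TangentSpace I p), P p X →
      0 ≤ mvfderiv I f p X ∧ (mvfderiv I f p X = 0 → 0 < mvfderiv I k p X))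
    {γ : ℝ → M} {a b : ℝ} (hab : a < b) (hγ : PiecewiseWithVelocity P γ a b) :
    toLex (f (γ a), k (γ a)) < toLex (f (γ b), k (γ b)) := by
  obtain ⟨n, t, rfl, rfl, ht⟩ := hγ
  have hpiece : ∀ i < n, toLex (f (γ (t i)), k (γ (t i))) <
      toLex (f (γ (t (i + 1))), k (γ (t (i + 1)))) := by
    intro i hi
    obtain ⟨hlt, hC, hvel⟩ := ht i hi
    have hd := hC.mdifferentiableOn one_ne_zero
    exact toLex_lt_toLex_of_hasDerivWithinAt hlt
      (fun s hs ↦ hasDerivWithinAt_comp_velocityWithin (hf _) (hd s hs))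
      (fun s hs ↦ hasDerivWithinAt_comp_velocityWithin (hk _) (hd s hs))
      (fun s hs ↦ (hP _ _ (hvel s hs)).1) (fun s hs ↦ (hP _ _ (hvel s hs)).2)
  have hn : 0 < n := Nat.pos_of_ne_zero fun h0 ↦ hab.ne (by rw [h0])
  exact strictMonoOn_Iic_of_lt_succ (ψ := fun i ↦ toLex (f (γ (t i)), k (γ (t i)))) hpiece
    (mem_Iic.2 hn.le) self_mem_Iic hn

variable [IsManifold I ∞ M] {g : LorentzianMetric I M} {p : M} {X Y : TangentSpace I p}

lemma IsCausalVector.inner_self_nonpos (hX : g.IsCausalVector X) : g.inner p X X ≤ 0 :=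
  hX.elim le_of_lt fun h ↦ h.2.le

lemma IsCausalVector.ne_zero (hX : g.IsCausalVector X) : X ≠ 0 := by
  rintro rfl
  exact hX.elim (fun h ↦ h.ne (map_zero _)) fun h ↦ h.1 rfl

lemma IsCausalVector.neg (hX : g.IsCausalVector X) : g.IsCausalVector (-X) := by
  simpa only [IsCausalVector, IsTimelike, IsLightlike, map_neg, neg_apply, neg_neg,
    neg_ne_zero] using hX

lemma inner_smul_add_smul_self (g : LorentzianMetric I M) (X Y : TangentSpace I p) (a b : ℝ) :
    g.inner p (a • X + b • Y) (a • X + b • Y) =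
      a ^ 2 * g.inner p X X + 2 * (a * b) * g.inner p X Y + b ^ 2 * g.inner p Y Y := by
  simp only [map_add, map_smul, add_apply, smul_apply, smul_eq_mul, g.symm p Y X]
  ring

lemma IsCausalVector.exists_eq_smul_of_inner_eq_zero (hX : g.IsCausalVector X)
    (hY : g.inner p Y Y ≤ 0) (hXY : g.inner p X Y = 0) : ∃ c : ℝ, Y = c • X := by
  obtain ⟨S, -, hpos⟩ := g.signature p
  have hSX : g.inner p S X ≠ 0 := fun h ↦ (hpos X h hX.ne_zero).not_ge hX.inner_self_nonpos
  set c : ℝ := g.inner p S Y / g.inner p S X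
  -- `Y - c X` is orthogonal to `S`, where the metric is positive definite
  have horth : g.inner p S (-c • X + (1 : ℝ) • Y) = 0 := by
    simp only [map_add, map_smul, smul_eq_mul, c]
    field_simp
    ring
  have hnonpos : g.inner p (-c • X + (1 : ℝ) • Y) (-c • X + (1 : ℝ) • Y) ≤ 0 := by
    rw [inner_smul_add_smul_self, hXY]
    nlinarith [mul_nonpos_of_nonneg_of_nonpos (sq_nonneg (-c)) hX.inner_self_nonpos]
  have hzero : -c • X + (1 : ℝ) • Y = 0 := by
    by_contra hne
    exact (hpos _ horth hne).not_ge hnonpos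
  refine ⟨c, ?_⟩
  rwa [neg_smul, one_smul, neg_add_eq_zero, eq_comm] at hzero

namespace TimeOrientation

variable {τ : g.TimeOrientation}

lemma PastDirected.neg (hX : τ.PastDirected X) : τ.FutureDirected (-X) :=
  ⟨hX.1.neg, by simpa only [map_neg, neg_apply, neg_lt_zero] using hX.2⟩

lemma PastDirected.inner_nonneg (hX : τ.PastDirected X) (hY : τ.FutureDirected Y) :
    0 ≤ g.inner p X Y := by
  by_contra! hneg
  set T := τ.field p
  have hXT : 0 < g.inner p X T := hX.2
  have hYT : g.inner p Y T < 0 := hY.2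
  -- a positive combination of `X` and `Y` orthogonal to `T`
  set Z := -g.inner p Y T • X + g.inner p X T • Y with hZ
  have hZT : g.inner p T Z = 0 := by
    rw [g.symm, hZ]
    simp only [map_add, map_smul, add_apply, smul_apply, smul_eq_mul]
    ring
  have hZZ : g.inner p Z Z < 0 := by
    rw [hZ, inner_smul_add_smul_self]
    have hXX := mul_nonpos_of_nonneg_of_nonpos (sq_nonneg (-g.inner p Y T))
      hX.1.inner_self_nonpos
    have hYY := mul_nonpos_of_nonneg_of_nonpos (sq_nonneg (g.inner p X T))
      hY.1.inner_self_nonpos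
    have hXY := mul_neg_of_pos_of_neg (mul_pos (neg_pos.2 hYT) hXT) hneg
    linarith
  obtain ⟨c, hc⟩ := IsCausalVector.exists_eq_smul_of_inner_eq_zero (Or.inl (τ.timelike p))
    hZZ.le hZT
  have hc0 : c = 0 := by
    rw [hc, map_smul, smul_eq_mul] at hZT
    exact (mul_eq_zero.1 hZT).resolve_right (τ.timelike p).ne
  rw [hc, hc0, zero_smul, map_zero] at hZZ
  exact hZZ.false

lemma PastDirected.exists_neg_smul_of_inner_eq_zero (hX : τ.PastDirected X)
    (hY : τ.FutureDirected Y) (hXY : g.inner p X Y = 0) : ∃ c < (0 : ℝ), Y = c • X := by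
  obtain ⟨c, rfl⟩ := hX.1.exists_eq_smul_of_inner_eq_zero hY.1.inner_self_nonpos hXY
  have hcX : c * g.inner p X (τ.field p) < 0 := by simpa using hY.2
  exact ⟨c, neg_of_mul_neg_left hcX hX.2.le, rfl⟩

end TimeOrientation

section Gradient

variable {τ : g.TimeOrientation} {f k : M → ℝ} {G : ∀ p : M, TangentSpace I p}

lemma IsGradientAt.mvfderiv_apply (hX : g.IsGradientAt f p X) (Y : TangentSpace I p) :
    mvfderiv I f p Y = g.inner p X Y :=
  (hX Y).symm

lemma IsGradientAt.mvfderiv_lex_of_futureDirected (hX : g.IsGradientAt f p X)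
    (hXτ : τ.PastDirected X) (hkX : 0 < mvfderiv I k p X) (hY : τ.FutureDirected Y) :
    0 ≤ mvfderiv I f p Y ∧ (mvfderiv I f p Y = 0 → mvfderiv I k p Y < 0) := by
  rw [hX.mvfderiv_apply]
  refine ⟨hXτ.inner_nonneg hY, fun h0 ↦ ?_⟩
  obtain ⟨c, hc, rfl⟩ := hXτ.exists_neg_smul_of_inner_eq_zero hY h0
  rw [map_smul, smul_eq_mul]
  exact mul_neg_of_neg_of_pos hc hkX

lemma isCausal_of_pastDirected_gradient (hf : MDifferentiable I 𝓘(ℝ, ℝ) f)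
    (hk : MDifferentiable I 𝓘(ℝ, ℝ) k) (hG : ∀ p, g.IsGradientAt f p (G p))
    (hGτ : ∀ p, τ.PastDirected (G p)) (hkG : ∀ p, 0 < mvfderiv I k p (G p)) : IsCausal τ := by
  have hlex (p : M) (X : TangentSpace I p) (hX : τ.FutureDirected X) :
      0 ≤ mvfderiv I f p X ∧ (mvfderiv I f p X = 0 → mvfderiv I k p X < 0) :=
    (hG p).mvfderiv_lex_of_futureDirected (hGτ p) (hkG p) hX
  rintro ⟨γ, a, b, hab, hγ | hγ, hclosed⟩
  · refine (hγ.toLex_lt_toLex hf hk.neg (fun p X hX ↦ ?_) hab).ne (by rw [hclosed])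
    simpa [mvfderiv_neg] using hlex p X hX
  · refine (hγ.toLex_lt_toLex hf.neg hk (fun p X hX ↦ ?_) hab).ne (by rw [hclosed])
    simpa [mvfderiv_neg] using hlex p (-X) hX.neg

lemma injOn_of_isCausalVector_velocityWithin {D : Set ℝ} (hD : Convex ℝ D)
    (hDu : UniqueDiffOn ℝ D) (hf : MDifferentiable I 𝓘(ℝ, ℝ) f)
    (hk : MDifferentiable I 𝓘(ℝ, ℝ) k) (hG : ∀ p, g.IsGradientAt f p (G p))
    (hGc : ∀ p, g.IsCausalVector (G p)) (hkG : ∀ p, mvfderiv I k p (G p) ≠ 0) {γ : ℝ → M}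
    (hγ : MDifferentiableOn 𝓘(ℝ, ℝ) I γ D)
    (hvel : ∀ s ∈ D, g.IsCausalVector (velocityWithin I γ D s))
    {c : ℝ} (hc : ∀ s ∈ D, f (γ s) = c) : InjOn γ D := by
  have hfvel (s : ℝ) (hs : s ∈ D) : mvfderiv I f (γ s) (velocityWithin I γ D s) = 0 :=
    (hDu s hs).eq_deriv _ (hasDerivWithinAt_comp_velocityWithin (hf _) (hγ s hs))
      ((hasDerivWithinAt_const s _ c).congr hc (hc s hs))
  have hkvel (s : ℝ) (hs : s ∈ D) : mvfderiv I k (γ s) (velocityWithin I γ D s) ≠ 0 := by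
    obtain ⟨r, hr⟩ := (hGc _).exists_eq_smul_of_inner_eq_zero (hvel s hs).inner_self_nonpos
      (((hG _).mvfderiv_apply _).symm.trans (hfvel s hs))
    have hr0 : r ≠ 0 := by
      rintro rfl
      exact (hvel s hs).ne_zero (hr.trans (zero_smul ℝ _))
    rw [hr, map_smul]
    exact smul_ne_zero hr0 (hkG _)
  have hinj : InjOn (fun s ↦ k (γ s)) D := injOn_of_hasDerivWithinAt_ne_zero hD
    (fun s hs ↦ hasDerivWithinAt_comp_velocityWithin (hk _) (hγ s hs)) hkvel
  exact fun s hs t ht h ↦ hinj hs ht (congrArg k h)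

lemma isQuasiTimeFunction_of_pastDirected_gradient (hf : ContMDiff I 𝓘(ℝ, ℝ) ∞ f)
    (hk : MDifferentiable I 𝓘(ℝ, ℝ) k) (hG : ∀ p, g.IsGradientAt f p (G p))
    (hGτ : ∀ p, τ.PastDirected (G p)) (hkG : ∀ p, mvfderiv I k p (G p) ≠ 0) :
    IsQuasiTimeFunction τ f := by
  refine ⟨hf, fun p ↦ ⟨G p, hG p, (hGτ p).1.ne_zero, (hGτ p).1, hGτ p⟩, ?_⟩
  rintro γ a b ⟨⟨hab, hγ, -⟩, hvel⟩ ⟨c, hc⟩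
  exact injOn_of_isCausalVector_velocityWithin (convex_Icc a b) (uniqueDiffOn_Icc hab)
    (hf.mdifferentiable (by simp)) hk hG (fun p ↦ (hGτ p).1) hkG
    (hγ.mdifferentiableOn two_ne_zero) (fun s hs ↦ Or.inr (hvel s hs)) hc

end Gradient

end LorentzianMetric

theorem theorem4p6_general [IsManifold I ∞ M] {g : LorentzianMetric I M} {τ : g.TimeOrientation}
    {f k : M → ℝ} (hf : ContMDiff I 𝓘(ℝ, ℝ) ∞ f) (hk : MDifferentiable I 𝓘(ℝ, ℝ) k)
    {G : ∀ p : M, TangentSpace I p} (hG : ∀ p, g.IsGradientAt f p (G p))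
    (hGτ : ∀ p, τ.PastDirected (G p)) (hkG : ∀ p, 0 < mvfderiv I k p (G p)) :
    LorentzianMetric.IsCausal τ ∧ LorentzianMetric.IsQuasiTimeFunction τ f :=
  ⟨LorentzianMetric.isCausal_of_pastDirected_gradient (hf.mdifferentiable (by simp)) hk hG hGτ hkG,
    LorentzianMetric.isQuasiTimeFunction_of_pastDirected_gradient hf hk hG hGτ
      fun p ↦ (hkG p).ne'⟩

end Lorentz

section Wave

variable {E : Type*} [NormedAddCommGroup E] [NormedSpace ℝ E]
  {N : Type*} [TopologicalSpace N] [ChartedSpace E N]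

lemma mdifferentiable_coord_v :
    MDifferentiable (waveModel E) 𝓘(ℝ, ℝ) (fun p : ℝ × ℝ × N ↦ p.2.1) :=
  mdifferentiable_fst.comp mdifferentiable_snd

lemma mvfderiv_coord_v_coordV (p : ℝ × ℝ × N) :
    mvfderiv (waveModel E) (fun p : ℝ × ℝ × N ↦ p.2.1) p (coordV E N p) = 1 := by
  have h := (hasMFDerivAt_fst (I := 𝓘(ℝ, ℝ)) (I' := 𝓘(ℝ, E)) p.2).comp p
    (hasMFDerivAt_snd (I := 𝓘(ℝ, ℝ)) (I' := 𝓘(ℝ, ℝ).prod 𝓘(ℝ, E)) p)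
  exact congrArg (fun L : (ℝ × ℝ × E) →L[ℝ] ℝ ↦ L (0, 1, 0)) h.mfderiv

lemma waveForm_coordV_left (H : ℝ) (A : E →L[ℝ] ℝ) (h : E →L[ℝ] E →L[ℝ] ℝ) (X : ℝ × ℝ × E) :
    waveForm H A h (0, 1, 0) X = X.1 := by
  simp [waveForm_apply]

lemma NhpWave.isGradientAt_coord_u [IsManifold 𝓘(ℝ, E) ∞ N] [FiniteDimensional ℝ E]
    (W : NhpWave E N) (p : ℝ × ℝ × N) :
    W.metric.IsGradientAt (fun p : ℝ × ℝ × N ↦ p.1) p (coordV E N p) := by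
  intro Y
  have hdu : mfderiv (waveModel E) 𝓘(ℝ, ℝ) (fun p : ℝ × ℝ × N ↦ p.1) p =
      ContinuousLinearMap.fst ℝ ℝ (ℝ × E) := (hasMFDerivAt_fst p).mfderiv
  rw [hdu]
  exact waveForm_coordV_left (E := E) _ _ _ Y

end Wave

theorem theorem4p6 {E : Type*} [NormedAddCommGroup E] [NormedSpace ℝ E] [FiniteDimensional ℝ E]
    {N : Type*} [TopologicalSpace N] [ChartedSpace E N] [IsManifold 𝓘(ℝ, E) ∞ N]
    [T2Space N] [SecondCountableTopology N] [ConnectedSpace N]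
    (W : NhpWave E N) (τ : W.metric.TimeOrientation)
    (hτ : ∀ p : ℝ × ℝ × N, τ.PastDirected (coordV E N p)) :
    LorentzianMetric.IsCausal τ ∧
      LorentzianMetric.IsQuasiTimeFunction τ (fun p : ℝ × ℝ × N ↦ p.1) :=
  theorem4p6_general contMDiff_fst mdifferentiable_coord_v W.isGradientAt_coord_u hτ
    fun p ↦ zero_lt_one.trans_eq (mvfderiv_coord_v_coordV p).symm
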